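/- Let $d>0$ and $\mathcal D_d=\{z\in\mathbb C: |\operatorname{Im} z|<d\}$. A function $\omega$ is called a weight function if it is analytic and zero-free in $\mathcal D_d$, satisfies $\lim_{x\to\pm\infty}\int_{-d}^{d}|\omega(x+iy)|\,dy=0$ and $\lim_{y\nearrow d}\int_{-\infty}^{\infty}(|\omega(x+iy)|+|\omega(x-iy)|)\,dx<\infty$, and on the real line takes values in $(0,1]$, is even, and is monotonically decreasing (in the weak sense) as $x$ goes away from $0$. It is of SE type if $\alpha_1 e^{-(\beta|x|)^\rho}\le\omega(x)\le\alpha_2 e^{-(\beta|x|)^\rho}$ for all $x\in\mathbb R$, with some $\alpha_1,\alpha_2,\beta>0$, $\rho\ge 1$; it is of DE type if $\alpha_1 e^{-\beta_1 e^{\gamma|x|}}\le\omega(x)\le\alpha_2 e^{-\beta_2 e^{\gamma|x|}}$ for all $x\in\mathbb R$, with some $\alpha_1,\alpha_2,\gamma>0$ and $\beta_1\ge\beta_2>0$. Let $H^\infty(\mathcal D_d,\omega)$ be the space of analytic $f:\mathcal D_d\to\mathbb C$ with $\|f\|=\sup_{z\in\mathcal D_d}|f(z)/\omega(z)|<\infty$,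 and for a quadrature rule $A_n(f)=\sum_{i=1}^n w_i f(\xi_i)$ with real nodes and weights let $$e^{\mathrm{wor}}(A_n,H^\infty(\mathcal D_d,\omega))=\sup_{\|f\|\le 1}\Bigl|A_n(f)-\int_{-\infty}^\infty f(x)\,dx\Bigr|.$$ Fix $L>0$ and let $\omega$ be a weight function of SE or DE type. Put $T=Ln^{1/(\rho+1)}$ in the SE case and $T=L\ln n$ in the DE case. For $n\ge 4$ let $A_n$ be the $n$-point Gauss–Legendre quadrature scaled from $[-1,1]$ to $[-T,T]$. Then there are constants $c,K>0$, independent of $n$, such that for all $n\ge 4$ $$e^{\mathrm{wor}}(A_n,H^\infty(\mathcal D_d,\omega))\ \ge\ K\,\frac{\exp\bigl(-c\,n^{\rho/(\rho+1)}\bigr)}{n^{5\rho/(\rho+1)}}\quad\text{(SE case)},\qquad e^{\mathrm{wor}}(A_n,H^\infty(\mathcal D_d,\omega))\ \ge\ K\,\frac{\exp\bigl(-c\,n/\ln n\bigr)}{(n/\ln n)^{5}}\quad\text{(DE case)}.$$ The same lower bounds, with possibly different constants $c,K>0$ independent of $n$, hold for all $n\ge 6$ when $A_n$ is the $n$-point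 Clenshaw–Curtis quadrature scaled from $[-1,1]$ to $[-T,T]$, i.e. the interpolatory rule at $T\cos(j\pi/(n-1))$, $j=0,\dots,n-1$. -/

import Mathlib

open Set Filter Topology MeasureTheory Polynomial
open scoped ENNReal

noncomputable section

namespace StripQuadrature

/-! ### The strip, weight functions, the weighted Hardy space -/

/-- The strip `𝒟_d = {z : |Im z| < d}`. -/
def strip (d : ℝ) : Set ℂ := {z | |z.im| < d}

/-- The space `B(𝒟_d)`: functions analytic on the strip, whose integrals over the vertical
cross-sections tend to `0` at `±∞`, and whose integrals over the two horizontal lines `Im z = ±y`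
have a finite limit as `y ↗ d`. (Functions on the strip are represented by functions on `ℂ`;
their values off the strip play no role.) -/
structure MemB (d : ℝ) (ω : ℂ → ℂ) : Prop where
  analytic : AnalyticOnNhd ℂ ω (strip d)
  tendsto_atTop : Tendsto
    (fun x : ℝ => ∫⁻ y in Ioo (-d) d, ‖ω ((x : ℂ) + (y : ℂ) * Complex.I)‖ₑ) atTop (𝓝 0)
  tendsto_atBot : Tendsto
    (fun x : ℝ => ∫⁻ y in Ioo (-d) d, ‖ω ((x : ℂ) + (y : ℂ) * Complex.I)‖ₑ) atBot (𝓝 0)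
  boundary : ∃ l : ℝ≥0∞, l < ∞ ∧ Tendsto
    (fun y : ℝ => ∫⁻ x : ℝ, (‖ω ((x : ℂ) + (y : ℂ) * Complex.I)‖ₑ
      + ‖ω ((x : ℂ) - (y : ℂ) * Complex.I)‖ₑ)) (𝓝[<] d) (𝓝 l)

/-- Weight functions: members of `B(𝒟_d)` without zeros in the strip which on the real line are
real with values in `(0, 1]`, even, and nonincreasing away from `0`. -/
structure IsWeight (d : ℝ) (ω : ℂ → ℂ) : Prop where
  memB : MemB d ω
  ne_zero : ∀ z ∈ strip d, ω z ≠ 0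
  im_eq_zero : ∀ x : ℝ, (ω (x : ℂ)).im = 0
  mem_Ioc : ∀ x : ℝ, (ω (x : ℂ)).re ∈ Ioc (0 : ℝ) 1
  even : ∀ x : ℝ, ω (-(x : ℂ)) = ω (x : ℂ)
  antitone : AntitoneOn (fun x : ℝ => (ω (x : ℂ)).re) (Ici 0)

/-- Single-exponential (SE) type with parameters `α₁, α₂, β > 0` and `ρ ≥ 1`. -/
def IsSE (ω : ℂ → ℂ) (α₁ α₂ β ρ : ℝ) : Prop :=
  0 < α₁ ∧ 0 < α₂ ∧ 0 < β ∧ 1 ≤ ρ ∧ ∀ x : ℝ,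
    α₁ * Real.exp (-(β * |x|) ^ ρ) ≤ (ω (x : ℂ)).re ∧
      (ω (x : ℂ)).re ≤ α₂ * Real.exp (-(β * |x|) ^ ρ)

/-- Double-exponential (DE) type with parameters `α₁, α₂, γ > 0` and `β₁ ≥ β₂ > 0`. -/
def IsDE (ω : ℂ → ℂ) (α₁ α₂ β₁ β₂ γ : ℝ) : Prop :=
  0 < α₁ ∧ 0 < α₂ ∧ 0 < β₁ ∧ 0 < β₂ ∧ 0 < γ ∧ β₂ ≤ β₁ ∧ ∀ x : ℝ,
    α₁ * Real.exp (-β₁ * Real.exp (γ * |x|)) ≤ (ω (x : ℂ)).re ∧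
      (ω (x : ℂ)).re ≤ α₂ * Real.exp (-β₂ * Real.exp (γ * |x|))

/-- The weighted norm `‖f‖ = sup_{z ∈ 𝒟_d} |f z / ω z|`, with values in `[0, ∞]`. -/
def hardyNorm (d : ℝ) (ω f : ℂ → ℂ) : ℝ≥0∞ := ⨆ z ∈ strip d, ‖f z / ω z‖ₑ

/-- The weighted Hardy space `H^∞(𝒟_d, ω)`. -/
def hardySpace (d : ℝ) (ω : ℂ → ℂ) : Set (ℂ → ℂ) :=
  {f | AnalyticOnNhd ℂ f (strip d) ∧ hardyNorm d ω f < ∞}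

/-! ### Quadrature rules -/

/-- A quadrature rule: finitely many distinct real nodes with real weights (the values of
`weight` off the nodes play no role). -/
structure Rule where
  nodes : Finset ℝ
  weight : ℝ → ℝ

/-- `A(f) = ∑ wᵢ f(ξᵢ)`. -/
def Rule.apply (A : Rule) (f : ℂ → ℂ) : ℂ := ∑ x ∈ A.nodes, (A.weight x : ℂ) * f (x : ℂ)

/-- The rule on `[-1, 1]` scaled to `[-T, T]`: nodes `T ξᵢ` and weights `T wᵢ`. -/
def Rule.scale (A : Rule) (T : ℝ) : Rule where
  nodes := A.nodes.image (fun x => T * x)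
  weight := fun x => T * A.weight (x / T)

/-- The interpolatory rule on `[-1, 1]` with node set `S`: the weight at `x` is the integral over
`[-1, 1]` of the Lagrange basis polynomial that is `1` at `x` and `0` at the other nodes. -/
def interpolatory (S : Finset ℝ) : Rule where
  nodes := S
  weight := fun x => ∫ t in (-1 : ℝ)..1, (Lagrange.basis S (id : ℝ → ℝ) x).eval t

/-- The Legendre polynomial `P_n = (1 / (2^n n!)) (d/dx)^n (x^2 - 1)^n`. -/
def legendre (n : ℕ) : ℝ[X] :=
  C (1 / ((2 : ℝ) ^ n * (n.factorial : ℝ))) * derivative^[n] ((X ^ 2 - 1) ^ n)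

/-- The `n`-point Gauss–Legendre rule on `[-1, 1]`: the interpolatory rule at the zeros of `P_n`. -/
def gaussLegendre (n : ℕ) : Rule := interpolatory (legendre n).roots.toFinset

/-- The `n`-point Clenshaw–Curtis rule on `[-1, 1]` (for `n ≥ 2`): the interpolatory rule at the
Chebyshev points `cos (j π / (n - 1))`, `j = 0, …, n - 1`, that is, at `±1` and the zeros of the
Chebyshev polynomial of the second kind of degree `n - 2`. -/
def clenshawCurtis (n : ℕ) : Rule :=
  interpolatory
    ((Finset.range n).image fun j : ℕ => Real.cos ((j : ℝ) * Real.pi / ((n : ℝ) - 1)))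

/-- The worst-case error of `A` in `H^∞(𝒟_d, ω)`: the supremum of `|A(f) - ∫_ℝ f|` over the
unit ball, with values in `[0, ∞]`. -/
def worstCaseError (d : ℝ) (ω : ℂ → ℂ) (A : Rule) : ℝ≥0∞ :=
  ⨆ f ∈ {f : ℂ → ℂ | f ∈ hardySpace d ω ∧ hardyNorm d ω f ≤ 1},
    ‖A.apply f - ∫ x : ℝ, f (x : ℂ)‖ₑ

end StripQuadrature

end

namespace StripQuadrature

/-! ### The hyperbolic tangent on a strip -/

/-! The bounds hold for every rule with at most `n` nodes; the weights, the position of the nodes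
and `L` play no role. Multiply `ω` by the squares of `tanh (π (z - ξ) / (4 d))` over all nodes `ξ`.
Each factor has modulus at most `1` on the strip, so this `foolingFun` lies in the unit ball. It
vanishes at the nodes and, thanks to the squares, is nonnegative on the real line, so its integral
bounds the error from below.

To bound that integral, dominate `-log |tanh u|` by a multiple of an integrable function. The sum of
its translates over the nodes has integral `O(n)`, so by Markov's inequality it is `O(n / T)` on at
least half of `[-T, T]`; there the product is at least `exp (-O(n / T))`
(`le_integral_foolingFunReal`). This `T` is free and is chosen to balance `n / T` against the decay
of `ω`. The resulting bound has no polynomial loss; the stated denominators are at least `1` and are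
only discarded. -/

theorem normSq_cosh_sub_normSq_sinh (z : ℂ) :
    Complex.normSq (Complex.cosh z) - Complex.normSq (Complex.sinh z) = Real.cos (2 * z.im) := by
  obtain ⟨x, y⟩ := z
  have h : (⟨x, y⟩ : ℂ) = (x : ℂ) + (y : ℂ) * Complex.I := by
    apply Complex.ext <;> simp
  rw [h, Complex.cosh_add, Complex.sinh_add, Complex.cosh_mul_I, Complex.sinh_mul_I,
    ← Complex.ofReal_cosh, ← Complex.ofReal_sinh, ← Complex.ofReal_cos, ← Complex.ofReal_sin]
  simp only [Complex.normSq_apply, Complex.add_re, Complex.add_im, Complex.mul_re, Complex.mul_im,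
    Complex.ofReal_re, Complex.ofReal_im, Complex.I_re, Complex.I_im]
  have h1 := Real.cosh_sq x
  have h2 := Real.cos_two_mul y
  have h3 := Real.sin_sq_add_cos_sq y
  simp only [mul_zero, mul_one, zero_mul, sub_zero, add_zero, zero_add]
  rw [h2]
  linear_combination (Real.cos y ^ 2 - Real.sin y ^ 2) * h1 - h3

theorem normSq_sinh_lt_normSq_cosh {z : ℂ} (hz : |z.im| < Real.pi / 4) :
    Complex.normSq (Complex.sinh z) < Complex.normSq (Complex.cosh z) := by
  have h := normSq_cosh_sub_normSq_sinh z
  rw [abs_lt] at hz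
  have : 0 < Real.cos (2 * z.im) :=
    Real.cos_pos_of_mem_Ioo ⟨by linarith, by linarith⟩
  linarith

theorem cosh_ne_zero_of_abs_im_lt {z : ℂ} (hz : |z.im| < Real.pi / 4) : Complex.cosh z ≠ 0 := by
  intro h
  have := normSq_sinh_lt_normSq_cosh hz
  rw [h, map_zero] at this
  exact absurd this (not_lt.mpr (Complex.normSq_nonneg _))

/-- This follows from `|cosh z|² - |sinh z|² = cos (2 Im z) > 0`; the scaling `π / (4 d)` maps the
strip of half-width `d` onto this one. -/
theorem norm_tanh_le_one {z : ℂ} (hz : |z.im| < Real.pi / 4) : ‖Complex.tanh z‖ ≤ 1 := by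
  rw [Complex.tanh_eq_sinh_div_cosh, norm_div]
  refine div_le_one_of_le₀ ?_ (norm_nonneg _)
  have := normSq_sinh_lt_normSq_cosh hz
  rw [Complex.normSq_eq_norm_sq, Complex.normSq_eq_norm_sq] at this
  exact (lt_of_pow_lt_pow_left₀ 2 (norm_nonneg _) this).le

theorem analyticAt_tanh {z : ℂ} (hz : |z.im| < Real.pi / 4) : AnalyticAt ℂ Complex.tanh z := by
  have : Complex.tanh = fun z => Complex.sinh z / Complex.cosh z :=
    funext Complex.tanh_eq_sinh_div_cosh
  rw [this]
  exact (Complex.analyticAt_sinh).div (Complex.analyticAt_cosh)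
    (cosh_ne_zero_of_abs_im_lt hz)

/-- An integrable majorant, up to a factor, of `-log |tanh u|`. -/
noncomputable def tanhMajorant (u : ℝ) : ℝ := |u| ^ (-(1 / 2) : ℝ) * Real.exp (-|u| / 2)

theorem tanhMajorant_nonneg (u : ℝ) : 0 ≤ tanhMajorant u :=
  mul_nonneg (Real.rpow_nonneg (abs_nonneg u) _) (Real.exp_pos _).le

/-- The majorant `y` is designed so that `u y² = exp (-u)`. With `u ≤ sinh u` this gives `cosh u =
sinh u + exp (-u) ≤ (1 + y²) sinh u ≤ exp (2 y) sinh u`. -/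
theorem exp_neg_tanhMajorant_le_tanh_of_pos {u : ℝ} (hu : 0 < u) :
    Real.exp (-(2 * tanhMajorant u)) ≤ Real.tanh u := by
  set y := tanhMajorant u with hy
  have hy0 : 0 ≤ y := tanhMajorant_nonneg u
  have hsq : u * y ^ 2 = Real.exp (-u) := by
    rw [hy, tanhMajorant, abs_of_pos hu, mul_pow, ← Real.rpow_natCast, ← Real.rpow_mul hu.le,
      ← Real.exp_nat_mul]
    norm_num
    rw [Real.rpow_neg_one, ← mul_assoc, mul_inv_cancel₀ hu.ne', one_mul]
    congr 1
    ring
  have hsinh : u ≤ Real.sinh u := Real.self_le_sinh_iff.mpr hu.le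
  have hcosh : Real.cosh u = Real.sinh u + Real.exp (-u) := by
    rw [← Real.cosh_sub_sinh]; ring
  have hexp : 1 + y ^ 2 ≤ Real.exp (2 * y) := by
    have h1 : (1 + y) ^ 2 ≤ Real.exp y ^ 2 :=
      pow_le_pow_left₀ (by linarith) (by linarith [Real.add_one_le_exp y]) 2
    rw [← Real.exp_nat_mul] at h1
    push_cast at h1
    nlinarith
  rw [Real.tanh_eq_sinh_div_cosh, le_div_iff₀ (Real.cosh_pos u), Real.exp_neg,
    inv_mul_le_iff₀ (Real.exp_pos _), hcosh]
  calc Real.sinh u + Real.exp (-u) ≤ (1 + y ^ 2) * Real.sinh u := by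
        nlinarith [mul_le_mul_of_nonneg_right hsinh (sq_nonneg y)]
    _ ≤ Real.exp (2 * y) * Real.sinh u :=
        mul_le_mul_of_nonneg_right hexp (by linarith)

theorem exp_neg_tanhMajorant_le_tanh_sq {u : ℝ} (hu : u ≠ 0) :
    Real.exp (-(4 * tanhMajorant u)) ≤ Real.tanh u ^ 2 := by
  have key : ∀ v : ℝ, 0 < v → Real.exp (-(4 * tanhMajorant v)) ≤ Real.tanh v ^ 2 := by
    intro v hv
    have h := pow_le_pow_left₀ (Real.exp_pos _).le (exp_neg_tanhMajorant_le_tanh_of_pos hv) 2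
    rw [← Real.exp_nat_mul] at h
    have he : -(4 * tanhMajorant v) = ((2 : ℕ) : ℝ) * -(2 * tanhMajorant v) := by
      push_cast
      ring
    rwa [he]
  rcases lt_or_gt_of_ne hu with h | h
  · have := key (-u) (by linarith)
    rwa [Real.tanh_neg, neg_sq, tanhMajorant, abs_neg] at this
  · exact key u h

theorem integrable_comp_abs {g : ℝ → ℝ} (hg : IntegrableOn g (Ioi 0)) :
    Integrable fun x => g |x| := by
  have h1 : IntegrableOn (fun x => g |x|) (Ioi 0) :=
    hg.congr_fun (fun x hx => by rw [abs_of_pos hx]) measurableSet_Ioi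
  have h2 : IntegrableOn (fun x => g |x|) (Iic 0) := by
    rw [integrableOn_Iic_iff_integrableOn_Iio]
    have := (h1.integrable_indicator measurableSet_Ioi).comp_neg
    rw [← integrable_indicator_iff measurableSet_Iio]
    refine this.congr (.of_forall fun x => ?_)
    simp [indicator]
  rw [← integrableOn_univ, ← Iic_union_Ioi (a := (0 : ℝ))]
  exact h2.union h1

theorem integrable_tanhMajorant : Integrable tanhMajorant := by
  have h := integrableOn_rpow_mul_exp_neg_mul_rpow (p := 1) (s := -(1 / 2)) (b := 1 / 2)
    (by norm_num) one_pos (by norm_num)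
  refine (integrable_comp_abs h).congr (.of_forall fun x => ?_)
  simp only [tanhMajorant, Real.rpow_one]
  congr 2
  ring

theorem integrable_exp_neg_mul_abs {b : ℝ} (hb : 0 < b) :
    Integrable fun x : ℝ => Real.exp (-b * |x|) :=
  integrable_comp_abs (g := fun x => Real.exp (-b * x)) (exp_neg_integrableOn_Ioi 0 hb)

/-! ### The fooling function -/

/-- The product of the weight with the squares of the functions
`z ↦ tanh (π (z - ξ) / (4 d))`, `ξ ∈ S`. -/
noncomputable def foolingFun (d : ℝ) (ω : ℂ → ℂ) (S : Finset ℝ) (z : ℂ) : ℂ :=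
  ω z * ∏ ξ ∈ S, Complex.tanh ((Real.pi / (4 * d) : ℝ) * (z - ξ)) ^ 2

/-- The restriction of `foolingFun` to the real line. -/
noncomputable def foolingFunReal (d : ℝ) (ω : ℂ → ℂ) (S : Finset ℝ) (x : ℝ) : ℝ :=
  (ω x).re * ∏ ξ ∈ S, Real.tanh (Real.pi / (4 * d) * (x - ξ)) ^ 2

section
variable {d : ℝ} {ω : ℂ → ℂ}

theorem ofReal_mem_strip (hd : 0 < d) (x : ℝ) : (x : ℂ) ∈ strip d := by
  simpa [strip] using hd

theorem abs_im_lt_of_mem_strip (hd : 0 < d) {z : ℂ} (hz : z ∈ strip d) (ξ : ℝ) :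
    |((Real.pi / (4 * d) : ℝ) * (z - ξ)).im| < Real.pi / 4 := by
  have hz' : |z.im| < d := hz
  have hpos : 0 < Real.pi / (4 * d) := by positivity
  rw [Complex.im_ofReal_mul, Complex.sub_im, Complex.ofReal_im, sub_zero, abs_mul,
    abs_of_pos hpos]
  calc Real.pi / (4 * d) * |z.im| < Real.pi / (4 * d) * d := mul_lt_mul_of_pos_left hz' hpos
    _ = Real.pi / 4 := by field_simp

theorem analyticOnNhd_foolingFun (hd : 0 < d) (hω : IsWeight d ω) (S : Finset ℝ) :
    AnalyticOnNhd ℂ (foolingFun d ω S) (strip d) := by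
  intro z hz
  refine (hω.memB.analytic z hz).mul (Finset.analyticAt_fun_prod _ fun ξ _ => ?_)
  refine AnalyticAt.pow ?_ 2
  exact (analyticAt_tanh (abs_im_lt_of_mem_strip hd hz ξ)).fun_comp (g := Complex.tanh)
    (f := fun z : ℂ => ((Real.pi / (4 * d) : ℝ) : ℂ) * (z - ξ))
    (analyticAt_const.mul (analyticAt_id.sub analyticAt_const))

theorem hardyNorm_foolingFun_le_one (hd : 0 < d) (hω : IsWeight d ω) (S : Finset ℝ) :
    hardyNorm d ω (foolingFun d ω S) ≤ 1 := by
  refine iSup₂_le fun z hz => ?_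
  rw [foolingFun, mul_div_cancel_left₀ _ (hω.ne_zero z hz), ← ofReal_norm, norm_prod,
    ENNReal.ofReal_le_one]
  refine Finset.prod_le_one (fun _ _ => norm_nonneg _) fun ξ _ => ?_
  rw [norm_pow]
  exact pow_le_one₀ (norm_nonneg _) (norm_tanh_le_one (abs_im_lt_of_mem_strip hd hz ξ))

theorem foolingFun_eq_zero_of_mem {S : Finset ℝ} {x : ℝ} (hx : x ∈ S) :
    foolingFun d ω S x = 0 := by
  rw [foolingFun, Finset.prod_eq_zero hx (by simp), mul_zero]

theorem foolingFun_ofReal (hω : IsWeight d ω) (S : Finset ℝ) (x : ℝ) :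
    foolingFun d ω S x = foolingFunReal d ω S x := by
  have h : ω x = ((ω x).re : ℂ) := Complex.ext (by simp) (by simpa using hω.im_eq_zero x)
  rw [foolingFun, foolingFunReal, h]
  push_cast
  simp

theorem foolingFunReal_nonneg (hω : IsWeight d ω) (S : Finset ℝ) (x : ℝ) :
    0 ≤ foolingFunReal d ω S x :=
  mul_nonneg (hω.mem_Ioc x).1.le (Finset.prod_nonneg fun _ _ => sq_nonneg _)

theorem foolingFunReal_le (hω : IsWeight d ω) (S : Finset ℝ) (x : ℝ) :
    foolingFunReal d ω S x ≤ (ω x).re := by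
  refine mul_le_of_le_one_right (hω.mem_Ioc x).1.le
    (Finset.prod_le_one (fun _ _ => sq_nonneg _) fun ξ _ => ?_)
  rw [sq_le_one_iff_abs_le_one]
  exact (Real.abs_tanh_lt_one _).le

theorem continuous_foolingFunReal (hd : 0 < d) (hω : IsWeight d ω) (S : Finset ℝ) :
    Continuous (foolingFunReal d ω S) := by
  have h : foolingFunReal d ω S = fun x : ℝ => (foolingFun d ω S x).re := by
    funext x
    rw [foolingFun_ofReal hω, Complex.ofReal_re]
  rw [h]
  refine Complex.continuous_re.comp (continuous_iff_continuousAt.mpr fun x => ?_)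
  exact ((analyticOnNhd_foolingFun hd hω S x (ofReal_mem_strip hd x)).continuousAt).comp
    (f := fun x : ℝ => (x : ℂ)) Complex.continuous_ofReal.continuousAt

theorem integrable_foolingFunReal (hd : 0 < d) (hω : IsWeight d ω) (S : Finset ℝ) {C b : ℝ}
    (hb : 0 < b) (hdecay : ∀ x : ℝ, (ω x).re ≤ C * Real.exp (-b * |x|)) :
    Integrable (foolingFunReal d ω S) := by
  refine ((integrable_exp_neg_mul_abs hb).const_mul C).mono'
    (continuous_foolingFunReal hd hω S).aestronglyMeasurable (.of_forall fun x => ?_)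
  rw [Real.norm_of_nonneg (foolingFunReal_nonneg hω S x)]
  exact (foolingFunReal_le hω S x).trans (hdecay x)

/-! ### A lower bound on the worst-case error of an arbitrary rule -/

theorem ofReal_integral_foolingFunReal_le_worstCaseError (hd : 0 < d) (hω : IsWeight d ω)
    (A : Rule) :
    ENNReal.ofReal (∫ x, foolingFunReal d ω A.nodes x) ≤ worstCaseError d ω A := by
  have hnorm := hardyNorm_foolingFun_le_one hd hω A.nodes
  refine le_iSup₂_of_le (foolingFun d ω A.nodes)
    ⟨⟨analyticOnNhd_foolingFun hd hω A.nodes, hnorm.trans_lt ENNReal.one_lt_top⟩, hnorm⟩ ?_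
  have h0 : A.apply (foolingFun d ω A.nodes) = 0 :=
    Finset.sum_eq_zero fun x hx => by rw [foolingFun_eq_zero_of_mem hx, mul_zero]
  simp_rw [h0, foolingFun_ofReal hω]
  rw [integral_complex_ofReal, zero_sub, enorm_neg, ← ofReal_norm, Complex.norm_real]
  exact ENNReal.ofReal_le_ofReal (le_abs_self _)

/-- The integral of the majorant of `-log |tanh (π x / (4 d))|`, increased by `1`. -/
noncomputable def majorantMass (d : ℝ) : ℝ :=
  -- The added `1` makes positivity immediate.
  (∫ x, tanhMajorant (Real.pi / (4 * d) * x)) + 1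

theorem majorantMass_pos (d : ℝ) : 0 < majorantMass d :=
  add_pos_of_nonneg_of_pos (integral_nonneg fun _ => tanhMajorant_nonneg _) one_pos

theorem exp_mul_le_foolingFunReal (hd : 0 < d) {S : Finset ℝ} {x m M : ℝ} (hx : x ∉ S)
    (hm : m ≤ (ω x).re) (hm0 : 0 ≤ m)
    (hM : ∑ ξ ∈ S, tanhMajorant (Real.pi / (4 * d) * (x - ξ)) ≤ M) :
    m * Real.exp (-(4 * M)) ≤ foolingFunReal d ω S x := by
  refine mul_le_mul hm ?_ (Real.exp_pos _).le (hm0.trans hm)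
  calc Real.exp (-(4 * M))
      ≤ Real.exp (∑ ξ ∈ S, -(4 * tanhMajorant (Real.pi / (4 * d) * (x - ξ)))) := by
        rw [Finset.sum_neg_distrib, ← Finset.mul_sum]
        exact Real.exp_le_exp.mpr (by linarith)
    _ = ∏ ξ ∈ S, Real.exp (-(4 * tanhMajorant (Real.pi / (4 * d) * (x - ξ)))) :=
        Real.exp_sum _ _
    _ ≤ _ := Finset.prod_le_prod (fun _ _ => (Real.exp_pos _).le) fun ξ hξ =>
        exp_neg_tanhMajorant_le_tanh_sq
          (mul_ne_zero (by positivity) (sub_ne_zero.mpr fun h => hx (h ▸ hξ)))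

/-- An averaging argument: the nodes cannot make the product small on most of `[-T, T]`, wherever
they lie. -/
theorem le_integral_foolingFunReal (hd : 0 < d) (hω : IsWeight d ω) {S : Finset ℝ} {n : ℕ}
    (hS : S.card ≤ n) (hn : 0 < n) {T m : ℝ} (hT : 0 < T) (hm0 : 0 ≤ m)
    (hm : ∀ x : ℝ, |x| ≤ T → m ≤ (ω x).re) {C b : ℝ}
    (hb : 0 < b) (hdecay : ∀ x : ℝ, (ω x).re ≤ C * Real.exp (-b * |x|)) :
    T * m * Real.exp (-(4 * majorantMass d) * (n / T)) ≤ ∫ x, foolingFunReal d ω S x := by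
  have hn' : (0 : ℝ) < n := Nat.cast_pos.mpr hn
  have hI := majorantMass_pos d
  set G : ℝ → ℝ := fun x => ∑ ξ ∈ S, tanhMajorant (Real.pi / (4 * d) * (x - ξ)) with hG
  -- With this threshold, Markov's inequality gives the bad set `{M ≤ G}` measure at most `T`, half
  -- the length of `[-T, T]`.
  set M : ℝ := n * majorantMass d / T with hM
  have hM0 : 0 < M := by positivity
  have hscaled : Integrable fun x => tanhMajorant (Real.pi / (4 * d) * x) :=
    integrable_tanhMajorant.comp_mul_left' (by positivity)
  have hGint : Integrable G := integrable_finsetSum _ fun ξ _ => hscaled.comp_sub_right ξ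
  have hGle : ∫ x, G x ≤ n * majorantMass d := by
    rw [hG, integral_finsetSum _ fun ξ _ => hscaled.comp_sub_right ξ]
    have : ∀ ξ : ℝ, ∫ x, tanhMajorant (Real.pi / (4 * d) * (x - ξ)) ≤ majorantMass d := by
      intro ξ
      rw [integral_sub_right_eq_self (fun x => tanhMajorant (Real.pi / (4 * d) * x)) ξ,
        majorantMass]
      linarith
    refine (Finset.sum_le_card_nsmul S _ _ fun ξ _ => this ξ).trans ?_
    rw [nsmul_eq_mul]
    exact mul_le_mul_of_nonneg_right (Nat.cast_le.mpr hS) hI.le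
  set B : Set ℝ := {x | M ≤ G x} with hB
  have hBfin : volume B ≠ ∞ := (hGint.measure_ge_lt_top hM0).ne
  have hBle : volume.real B ≤ T := by
    have h := mul_meas_ge_le_integral_of_nonneg
      (.of_forall fun x => Finset.sum_nonneg fun _ _ => tanhMajorant_nonneg _) hGint M
    have h' : M * volume.real B ≤ M * T := by
      refine (h.trans hGle).trans_eq ?_
      rw [hM]
      field_simp
    exact le_of_mul_le_mul_left h' hM0
  have hGmeas : Measurable G := by
    refine Finset.measurable_fun_sum _ fun ξ _ => ?_
    unfold tanhMajorant
    fun_prop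
  -- The nodes must be removed separately: `tanhMajorant 0 = 0` by the convention for `0 ^ (-1 /
  -- 2)`, so the majorant does not detect the zeros of `tanh`.
  set E : Set ℝ := Icc (-T) T \ (B ∪ S) with hE
  have hBmeas : MeasurableSet B := measurableSet_le measurable_const hGmeas
  have hEmeas : MeasurableSet E :=
    measurableSet_Icc.diff (hBmeas.union S.measurableSet)
  have hEfin : volume E ≠ ∞ :=
    ((measure_mono sdiff_subset).trans_lt measure_Icc_lt_top).ne
  have hEge : T ≤ volume.real E := by
    have hfin : volume (B ∪ (S : Set ℝ)) ≠ ∞ :=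
      (measure_union_lt_top hBfin.lt_top ((S.finite_toSet.measure_zero volume).trans_lt ENNReal.zero_lt_top)).ne
    have h1 : volume.real (Icc (-T) T) - volume.real (B ∪ S) ≤ volume.real E :=
      le_measureReal_sdiff hfin
    have h2 : volume.real (B ∪ (S : Set ℝ)) ≤ volume.real B + volume.real (S : Set ℝ) :=
      measureReal_union_le _ _
    have h3 : volume.real (S : Set ℝ) = 0 := by
      rw [measureReal_def, S.finite_toSet.measure_zero, ENNReal.toReal_zero]
    rw [Real.volume_real_Icc_of_le (by linarith)] at h1
    linarith
  have hint := integrable_foolingFunReal hd hω S hb hdecay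
  have hlow : ∀ x ∈ E, m * Real.exp (-(4 * M)) ≤ foolingFunReal d ω S x := by
    rintro x ⟨hxT, hx⟩
    rw [mem_union, not_or] at hx
    exact exp_mul_le_foolingFunReal hd hx.2 (hm x (abs_le.mpr hxT)) hm0 (not_le.mp hx.1).le
  calc T * m * Real.exp (-(4 * majorantMass d) * (n / T))
      = m * Real.exp (-(4 * M)) * T := by
        rw [hM, show -(4 * (n * majorantMass d / T)) = -(4 * majorantMass d) * (n / T) by ring]
        ring
    _ ≤ m * Real.exp (-(4 * M)) * volume.real E :=
        mul_le_mul_of_nonneg_left hEge (by positivity)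
    _ ≤ ∫ x in E, foolingFunReal d ω S x :=
        setIntegral_ge_of_const_le_real hEmeas hEfin hlow hint.integrableOn
    _ ≤ ∫ x, foolingFunReal d ω S x :=
        setIntegral_le_integral hint (.of_forall fun x => foolingFunReal_nonneg hω S x)

/-- Any rule with at most `n` nodes has worst-case error at least
`T m exp (-4 I n / T)`, where `m` bounds the weight from below on `[-T, T]`. -/
theorem ofReal_le_worstCaseError (hd : 0 < d) (hω : IsWeight d ω) {A : Rule} {n : ℕ}
    (hA : A.nodes.card ≤ n) (hn : 0 < n) {T m : ℝ} (hT : 0 < T) (hm0 : 0 ≤ m)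
    (hm : ∀ x : ℝ, |x| ≤ T → m ≤ (ω x).re) {C b : ℝ}
    (hb : 0 < b) (hdecay : ∀ x : ℝ, (ω x).re ≤ C * Real.exp (-b * |x|)) :
    ENNReal.ofReal (T * m * Real.exp (-(4 * majorantMass d) * (n / T)))
      ≤ worstCaseError d ω A :=
  (ENNReal.ofReal_le_ofReal
    (le_integral_foolingFunReal hd hω hA hn hT hm0 hm hb hdecay)).trans
    (ofReal_integral_foolingFunReal_le_worstCaseError hd hω A)

/-! ### Weights of single- and double-exponential type -/

/-- The choice `T = n ^ (1 / (ρ + 1))` balances the two losses: `T ^ ρ = n / T = n ^ (ρ / (ρ + 1))`.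
-/
theorem IsSE.exists_lower_bound (hd : 0 < d) (hω : IsWeight d ω) {α₁ α₂ β ρ : ℝ}
    (h : IsSE ω α₁ α₂ β ρ) :
    ∃ c : ℝ, 0 < c ∧ ∃ K : ℝ, 0 < K ∧ ∀ n : ℕ, 0 < n → ∀ A : Rule, A.nodes.card ≤ n →
      ENNReal.ofReal (K * (Real.exp (-c * (n : ℝ) ^ (ρ / (ρ + 1)))
        / (n : ℝ) ^ (5 * ρ / (ρ + 1)))) ≤ worstCaseError d ω A := by
  obtain ⟨h1, h2, hβ, hρ, hb⟩ := h
  have hI := majorantMass_pos d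
  refine ⟨β ^ ρ + 4 * majorantMass d, by positivity, α₁, h1, fun n hn A hA => ?_⟩
  have hn1 : (1 : ℝ) ≤ n := Nat.one_le_cast.mpr hn
  have hn0 : (0 : ℝ) < n := by linarith
  have hρ1 : 0 < ρ + 1 := by linarith
  set N : ℝ := (n : ℝ) ^ (ρ / (ρ + 1)) with hN
  set T : ℝ := (n : ℝ) ^ (1 / (ρ + 1)) with hT
  have hT1 : 1 ≤ T := Real.one_le_rpow hn1 (by positivity)
  have hT0 : 0 < T := by linarith
  have hTρ : T ^ ρ = N := by
    rw [hT, ← Real.rpow_mul hn0.le, hN]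
    congr 1
    ring
  have hnT : n / T = N := by
    rw [div_eq_iff hT0.ne', hN, hT, ← Real.rpow_add hn0, ← add_div, div_self hρ1.ne',
      Real.rpow_one]
  -- The factor `exp 1` covers `β |x| ≤ 1`, where `(β |x|) ^ ρ` may fall below `β |x|`.
  have hdecay : ∀ x : ℝ, (ω x).re ≤ α₂ * Real.exp 1 * Real.exp (-β * |x|) := by
    intro x
    refine (hb x).2.trans ?_
    rw [mul_assoc, ← Real.exp_add]
    refine mul_le_mul_of_nonneg_left (Real.exp_le_exp.mpr ?_) h2.le
    rcases le_total (β * |x|) 1 with hx | hx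
    · have : 0 ≤ (β * |x|) ^ ρ := by positivity
      linarith
    · have : β * |x| ≤ (β * |x|) ^ ρ := Real.self_le_rpow_of_one_le hx hρ
      linarith
  have hlow : ∀ x : ℝ, |x| ≤ T → α₁ * Real.exp (-(β ^ ρ * N)) ≤ (ω x).re := by
    intro x hx
    refine le_trans (mul_le_mul_of_nonneg_left (Real.exp_le_exp.mpr ?_) h1.le) (hb x).1
    rw [← hTρ, ← Real.mul_rpow hβ.le hT0.le]
    exact neg_le_neg (Real.rpow_le_rpow (by positivity)
      (mul_le_mul_of_nonneg_left hx hβ.le) (by linarith))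
  refine le_trans (ENNReal.ofReal_le_ofReal ?_)
    (ofReal_le_worstCaseError hd hω hA hn hT0 (by positivity) hlow hβ hdecay)
  rw [hnT]
  calc α₁ * (Real.exp (-(β ^ ρ + 4 * majorantMass d) * N) / (n : ℝ) ^ (5 * ρ / (ρ + 1)))
      ≤ α₁ * Real.exp (-(β ^ ρ + 4 * majorantMass d) * N) :=
        mul_le_mul_of_nonneg_left (div_le_self (Real.exp_pos _).le
          (Real.one_le_rpow hn1 (by positivity))) h1.le
    _ = 1 * (α₁ * Real.exp (-(β ^ ρ * N))) * Real.exp (-(4 * majorantMass d) * N) := by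
        rw [one_mul, mul_assoc, ← Real.exp_add]
        congr 2
        ring
    _ ≤ T * (α₁ * Real.exp (-(β ^ ρ * N))) * Real.exp (-(4 * majorantMass d) * N) :=
        mul_le_mul_of_nonneg_right (mul_le_mul_of_nonneg_right hT1 (by positivity))
          (Real.exp_pos _).le

/-- Here `T = log n / (2 γ)`, so that `exp (γ T) = √n`. Since `log n ≤ 2 √n`, this is at most `2 n /
log n`, the same order as `n / T`. -/
theorem IsDE.exists_lower_bound (hd : 0 < d) (hω : IsWeight d ω) {α₁ α₂ β₁ β₂ γ : ℝ}
    (h : IsDE ω α₁ α₂ β₁ β₂ γ) :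
    ∃ c : ℝ, 0 < c ∧ ∃ K : ℝ, 0 < K ∧ ∀ n : ℕ, 4 ≤ n → ∀ A : Rule, A.nodes.card ≤ n →
      ENNReal.ofReal (K * (Real.exp (-c * ((n : ℝ) / Real.log n))
        / ((n : ℝ) / Real.log n) ^ 5)) ≤ worstCaseError d ω A := by
  obtain ⟨h1, h2, hβ₁, hβ₂, hγ, -, hb⟩ := h
  have hI := majorantMass_pos d
  refine ⟨2 * β₁ + 8 * γ * majorantMass d, by positivity, α₁ / (2 * γ), by positivity,
    fun n hn A hA => ?_⟩
  have hn4 : (4 : ℝ) ≤ n := by exact_mod_cast hn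
  have hn0 : (0 : ℝ) < n := by linarith
  have hlog1 : 1 ≤ Real.log n := by
    rw [Real.le_log_iff_exp_le hn0]
    linarith [Real.exp_one_lt_d9]
  have hlog0 : 0 < Real.log n := by linarith
  set N : ℝ := n / Real.log n with hN
  have hN1 : 1 ≤ N := by
    rw [hN, one_le_div hlog0]
    linarith [Real.log_le_sub_one_of_pos hn0]
  set T : ℝ := Real.log n / (2 * γ) with hT
  have hT0 : 0 < T := by positivity
  have hT1 : 1 / (2 * γ) ≤ T := div_le_div_of_nonneg_right hlog1 (by positivity)
  have hnT : n / T = 2 * γ * N := by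
    rw [hT, hN]
    field_simp
  have hexpT : Real.exp (γ * T) ≤ 2 * N := by
    have hs : Real.exp (γ * T) = (n : ℝ) ^ (1 / 2 : ℝ) := by
      rw [Real.rpow_def_of_pos hn0, hT]
      congr 1
      field_simp
    have hsq : (n : ℝ) ^ (1 / 2 : ℝ) * (n : ℝ) ^ (1 / 2 : ℝ) = n := by
      rw [← Real.rpow_add hn0]
      norm_num
    have hl : Real.log n ≤ (n : ℝ) ^ (1 / 2 : ℝ) / (1 / 2) :=
      Real.log_le_rpow_div hn0.le (by norm_num)
    have hp : 0 < (n : ℝ) ^ (1 / 2 : ℝ) := by positivity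
    rw [hs, hN, ← mul_div_assoc, le_div_iff₀ hlog0]
    nlinarith
  have hdecay : ∀ x : ℝ, (ω x).re ≤ α₂ * Real.exp (-(β₂ * γ) * |x|) := by
    intro x
    refine (hb x).2.trans (mul_le_mul_of_nonneg_left (Real.exp_le_exp.mpr ?_) h2.le)
    nlinarith [Real.add_one_le_exp (γ * |x|)]
  have hlow : ∀ x : ℝ, |x| ≤ T → α₁ * Real.exp (-(2 * β₁ * N)) ≤ (ω x).re := by
    intro x hx
    refine le_trans (mul_le_mul_of_nonneg_left (Real.exp_le_exp.mpr ?_) h1.le) (hb x).1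
    have : Real.exp (γ * |x|) ≤ 2 * N :=
      (Real.exp_le_exp.mpr (mul_le_mul_of_nonneg_left hx hγ.le)).trans hexpT
    nlinarith
  refine le_trans (ENNReal.ofReal_le_ofReal ?_)
    (ofReal_le_worstCaseError hd hω hA (by omega) hT0 (by positivity) hlow
      (mul_pos hβ₂ hγ) hdecay)
  rw [hnT]
  calc α₁ / (2 * γ) * (Real.exp (-(2 * β₁ + 8 * γ * majorantMass d) * N) / N ^ 5)
      ≤ α₁ / (2 * γ) * Real.exp (-(2 * β₁ + 8 * γ * majorantMass d) * N) :=
        mul_le_mul_of_nonneg_left (div_le_self (Real.exp_pos _).le (one_le_pow₀ hN1))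
          (by positivity)
    _ = 1 / (2 * γ) * (α₁ * Real.exp (-(2 * β₁ * N)))
          * Real.exp (-(4 * majorantMass d) * (2 * γ * N)) := by
        rw [show -(2 * β₁ + 8 * γ * majorantMass d) * N
            = -(2 * β₁ * N) + -(4 * majorantMass d) * (2 * γ * N) by ring, Real.exp_add]
        ring
    _ ≤ T * (α₁ * Real.exp (-(2 * β₁ * N)))
          * Real.exp (-(4 * majorantMass d) * (2 * γ * N)) :=
        mul_le_mul_of_nonneg_right (mul_le_mul_of_nonneg_right hT1 (by positivity))
          (Real.exp_pos _).le

end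

/-! ### The number of nodes of the Gauss–Legendre and Clenshaw–Curtis rules -/

theorem natDegree_legendre_le (n : ℕ) : (legendre n).natDegree ≤ n := by
  have h2 : ((X : ℝ[X]) ^ 2 - 1).natDegree ≤ 2 := by compute_degree
  have h : (((X : ℝ[X]) ^ 2 - 1) ^ n).natDegree ≤ n * 2 := natDegree_pow_le_of_le n h2
  refine (natDegree_C_mul_le _ _).trans ((natDegree_iterate_derivative _ n).trans ?_)
  omega

/-- Only an upper bound is needed, so the zeros of `P_n` need not be shown to be real or simple. -/
theorem card_nodes_gaussLegendre_scale_le (n : ℕ) (T : ℝ) :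
    ((gaussLegendre n).scale T).nodes.card ≤ n :=
  Finset.card_image_le.trans ((Multiset.toFinset_card_le _).trans
    ((card_roots' _).trans (natDegree_legendre_le n)))

theorem card_nodes_clenshawCurtis_scale_le (n : ℕ) (T : ℝ) :
    ((clenshawCurtis n).scale T).nodes.card ≤ n :=
  Finset.card_image_le.trans (Finset.card_image_le.trans_eq (Finset.card_range n))

end StripQuadrature

theorem mainTheorem5 (d L : ℝ) (hd : 0 < d) (hL : 0 < L) (ω : ℂ → ℂ)
    (hω : StripQuadrature.IsWeight d ω) :
    (∀ α₁ α₂ β ρ : ℝ, StripQuadrature.IsSE ω α₁ α₂ β ρ →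
      (∃ c : ℝ, 0 < c ∧ ∃ K : ℝ, 0 < K ∧ ∀ n : ℕ, 4 ≤ n →
        ENNReal.ofReal (K * (Real.exp (-c * (n : ℝ) ^ (ρ / (ρ + 1)))
            / (n : ℝ) ^ (5 * ρ / (ρ + 1))))
          ≤ StripQuadrature.worstCaseError d ω
              ((StripQuadrature.gaussLegendre n).scale (L * (n : ℝ) ^ (1 / (ρ + 1))))) ∧
      (∃ c : ℝ, 0 < c ∧ ∃ K : ℝ, 0 < K ∧ ∀ n : ℕ, 6 ≤ n →
        ENNReal.ofReal (K * (Real.exp (-c * (n : ℝ) ^ (ρ / (ρ + 1)))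
            / (n : ℝ) ^ (5 * ρ / (ρ + 1))))
          ≤ StripQuadrature.worstCaseError d ω
              ((StripQuadrature.clenshawCurtis n).scale (L * (n : ℝ) ^ (1 / (ρ + 1)))))) ∧
    (∀ α₁ α₂ β₁ β₂ γ : ℝ, StripQuadrature.IsDE ω α₁ α₂ β₁ β₂ γ →
      (∃ c : ℝ, 0 < c ∧ ∃ K : ℝ, 0 < K ∧ ∀ n : ℕ, 4 ≤ n →
        ENNReal.ofReal (K * (Real.exp (-c * ((n : ℝ) / Real.log n))
            / ((n : ℝ) / Real.log n) ^ 5))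
          ≤ StripQuadrature.worstCaseError d ω
              ((StripQuadrature.gaussLegendre n).scale (L * Real.log n))) ∧
      (∃ c : ℝ, 0 < c ∧ ∃ K : ℝ, 0 < K ∧ ∀ n : ℕ, 6 ≤ n →
        ENNReal.ofReal (K * (Real.exp (-c * ((n : ℝ) / Real.log n))
            / ((n : ℝ) / Real.log n) ^ 5))
          ≤ StripQuadrature.worstCaseError d ω
              ((StripQuadrature.clenshawCurtis n).scale (L * Real.log n)))) := by
  refine ⟨fun α₁ α₂ β ρ h => ?_, fun α₁ α₂ β₁ β₂ γ h => ?_⟩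
  · obtain ⟨c, hc, K, hK, H⟩ := h.exists_lower_bound hd hω
    exact ⟨⟨c, hc, K, hK, fun n hn => H n (by omega) _
        (StripQuadrature.card_nodes_gaussLegendre_scale_le n _)⟩,
      ⟨c, hc, K, hK, fun n hn => H n (by omega) _
        (StripQuadrature.card_nodes_clenshawCurtis_scale_le n _)⟩⟩
  · obtain ⟨c, hc, K, hK, H⟩ := h.exists_lower_bound hd hω
    exact ⟨⟨c, hc, K, hK, fun n hn => H n hn _
        (StripQuadrature.card_nodes_gaussLegendre_scale_le n _)⟩,
      ⟨c, hc, K, hK, fun n hn => H n (by omega) _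
        (StripQuadrature.card_nodes_clenshawCurtis_scale_le n _)⟩⟩
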